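/- Let $X$ be a finite set and $r:X\times X\to X\times X$, $r(x,y)=({}^xy,x^y)$, a nondegenerate (all maps $\mathcal L_x:y\mapsto {}^xy$ and $\mathcal R_y:x\mapsto x^y$ are bijective), involutive ($r^2=\mathrm{id}$), square-free ($r(x,x)=(x,x)$ for all $x$) set-theoretic solution of the Yang–Baxter equation $r^{12}r^{23}r^{12}=r^{23}r^{12}r^{23}$. Suppose that $(X,r)$ is a multipermutation solution of level $2$: if $\mathrm{Ret}(X,r)$ denotes the solution induced by $r$ on the set of classes of the relation $x\sim y\Leftrightarrow\mathcal L_x=\mathcal L_y$, then $m=2$ is the least $m\ge 0$ such that $\mathrm{Ret}^m(X,r)$ is the solution on a one-element set. Let $X_1,\dots,X_t$ be the orbits in $X$ of the group generated by all $\mathcal L_x$, let $\mathcal G_i\subseteq\mathrm{Sym}(X_i)$ be the group generated by the restrictions $\mathcal L_x|_{X_i}$, $x\in X$, let $\mathcal G_i^*=\mathrm{Hom}(\mathcal G_i,\mathbb C^\times)$, and put $$\mathcal H=\prod_i\mathcal G_i,\qquad \mathcal H^*=\prod_i\mathcal G_i^*,\qquad H=\mathcal H^*\times\mathcal H .$$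 Evaluate $\chi=(\chi_i)_i\in\mathcal H^*$ at $g=(g_i)_i\in\mathcal H$ by $\chi(g)=\prod_i\chi_i(g_i)$. For $x\in X$ let $\gamma_x=(\mathcal L_x|_{X_j})_j\in\mathcal H$. Let $V=\mathbb CX$, on which $\mathcal H$ acts linearly, the factor $\mathcal G_i$ permuting $X_i$ and fixing every element of $X_j$ for $j\neq i$. For $(\chi,g)\in H$ let $$V_{(\chi,g)}=\{v\in\mathrm{span}\{x\in X:\gamma_x=g\}\ :\ h\cdot v=\chi(h)v\ \text{ for all } h\in\mathcal H\}.$$ Let $\mathbb C[V]$ be the symmetric algebra of $V$ (polynomials in $|X|$ variables), and for $a\in H$ let $\mathbb C[V]_a$ be the span of all products $v_1\cdots v_n$ ($n\ge 0$) with $v_k\in V_{h_k}$ and $h_1\cdots h_n=a$. Let $\mathcal F:H\times H\to\mathbb C^\times$ be given by $$\mathcal F((\chi,g),(\chi',h))=\chi'(g).$$ Let $R:V\otimes V\to V\otimes V$ be the linear extension of $r$, let $\mathbb C_R[V]$ be the tensor algebra of $V$ modulo the two-sided ideal generated by the image of $\mathrm{id}-R$, and let $\mathcal A(\mathbb C,X,r)$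 be the $\mathbb C$-algebra with generators $X$ and relations $xy=zt$ whenever $r(x,y)=(z,t)$. **Proposition.** The following hold. 1. $\gamma_x$ depends only on the orbit $X_i$ of $x$, the group $H$ is abelian, $V=\bigoplus_{a\in H}V_a$, and $\mathbb C[V]=\bigoplus_{a\in H}\mathbb C[V]_a$ is an $H$-graded algebra. 2. $\mathcal F$ is a 2-cocycle on $H$, i.e. $\mathcal F(a,bc)\mathcal F(b,c)=\mathcal F(a,b)\mathcal F(ab,c)$ and $\mathcal F(e,a)=1$ for all $a,b,c\in H$. Hence the vector space $\mathbb C[V]$ is an associative algebra $\mathbb C[V]^{\mathcal F}$ (the cotwist) under the bilinear product with $f\bullet g=\mathcal F(a,b)\,fg$ for $f\in\mathbb C[V]_a$, $g\in\mathbb C[V]_b$. 3. The algebra $\mathbb C[V]^{\mathcal F}$ is isomorphic to $\mathbb C_R[V]$, by an isomorphism that sends each $v\in V\subseteq \mathbb C[V]^{\mathcal F}$ to the class of $v$, and hence to $\mathcal A(\mathbb C,X,r)$, by an isomorphism that sends each $x\in X$ to the generator $x$. -/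

import Mathlib

open scoped TensorProduct

universe u v w

/-! ## Twisting a group-graded algebra by a 2-cocycle -/

section Cotwist

variable {k : Type u} {A : Type v} {H : Type w} [Field k] [Ring A] [Algebra k A] [Group H]

/-- A normalised 2-cocycle on the group `H` with values in `kˣ` (trivial action). -/
structure IsTwoCocycle (F : H → H → kˣ) : Prop where
  cocycle : ∀ a b c : H, F a (b * c) * F b c = F a b * F (a * b) c
  one_left : ∀ a : H, F 1 a = 1

theorem IsTwoCocycle.one_right {F : H → H → kˣ} (hF : IsTwoCocycle F) (a : H) : F a 1 = 1 := by
  have h := hF.cocycle a 1 1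
  simpa [hF.one_left] using h

variable [DecidableEq H] (𝒜 : Additive H → Submodule k A) [GradedAlgebra 𝒜]

/-- The twisted product as a bilinear map on `A`: the bilinear extension of
`(f, g) ↦ F(a, b) f g` for `f` of degree `a` and `g` of degree `b`
(see `bullet_of_mem`).  The group `H` is written multiplicatively; `Additive H` only serves to
use graded algebras in the form in which the library provides them. -/
noncomputable def bullet (F : H → H → kˣ) : A →ₗ[k] A →ₗ[k] A :=
  (DirectSum.toModule k (Additive H) ((DirectSum (Additive H) fun b => 𝒜 b) →ₗ[k] A) fun a =>
      LinearMap.flip <| DirectSum.toModule k (Additive H) (𝒜 a →ₗ[k] A) fun b =>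
        LinearMap.flip
          ((F a.toMul b.toMul : k) • (LinearMap.mul k A).domRestrict₁₂ (𝒜 a) (𝒜 b))).compl₁₂
    (DirectSum.decomposeLinearEquiv 𝒜).toLinearMap
    (DirectSum.decomposeLinearEquiv 𝒜).toLinearMap

theorem bullet_of_mem (F : H → H → kˣ) {a b : Additive H} {f g : A} (hf : f ∈ 𝒜 a)
    (hg : g ∈ 𝒜 b) : bullet 𝒜 F f g = (F a.toMul b.toMul : k) • (f * g) := by
  lift f to 𝒜 a using hf
  lift g to 𝒜 b using hg
  simp only [bullet, LinearMap.compl₁₂_apply, LinearEquiv.coe_coe,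
    DirectSum.decomposeLinearEquiv_apply, DirectSum.decompose_coe, ← DirectSum.lof_eq_of k,
    DirectSum.toModule_lof, LinearMap.flip_apply]
  rfl

theorem bullet_assoc {F : H → H → kˣ} (hF : IsTwoCocycle F) (f g h : A) :
    bullet 𝒜 F (bullet 𝒜 F f g) h = bullet 𝒜 F f (bullet 𝒜 F g h) := by
  induction f using DirectSum.Decomposition.inductionOn 𝒜 with
  | zero => simp
  | add f f' h1 h2 => simp [h1, h2]
  | @homogeneous a f =>
  induction g using DirectSum.Decomposition.inductionOn 𝒜 with
  | zero => simp
  | add f f' h1 h2 => simp [h1, h2]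
  | @homogeneous b g =>
  induction h using DirectSum.Decomposition.inductionOn 𝒜 with
  | zero => simp
  | add f f' h1 h2 => simp [h1, h2]
  | @homogeneous c h =>
  rw [bullet_of_mem 𝒜 F f.2 g.2, bullet_of_mem 𝒜 F g.2 h.2, map_smul, map_smul,
    LinearMap.smul_apply, bullet_of_mem 𝒜 F (SetLike.mul_mem_graded f.2 g.2) h.2,
    bullet_of_mem 𝒜 F f.2 (SetLike.mul_mem_graded g.2 h.2), smul_smul, smul_smul, mul_assoc]
  congr 1
  have := congrArg (Units.val) (hF.cocycle a.toMul b.toMul c.toMul)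
  simp only [Units.val_mul] at this
  simp only [toMul_add]
  rw [← this, mul_comm]

theorem one_bullet {F : H → H → kˣ} (hF : IsTwoCocycle F) (f : A) : bullet 𝒜 F 1 f = f := by
  induction f using DirectSum.Decomposition.inductionOn 𝒜 with
  | zero => simp
  | add f f' h1 h2 => simp [h1, h2]
  | @homogeneous a f =>
  rw [bullet_of_mem 𝒜 F (SetLike.one_mem_graded 𝒜) f.2]
  simp [hF.one_left]

theorem bullet_one {F : H → H → kˣ} (hF : IsTwoCocycle F) (f : A) : bullet 𝒜 F f 1 = f := by
  induction f using DirectSum.Decomposition.inductionOn 𝒜 with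
  | zero => simp
  | add f f' h1 h2 => simp [h1, h2]
  | @homogeneous a f =>
  rw [bullet_of_mem 𝒜 F f.2 (SetLike.one_mem_graded 𝒜)]
  simp [hF.one_right]

/-- The cotwist `A^F`: the vector space `A` with the twisted product `bullet`. -/
@[nolint unusedArguments]
def Cotwist (_ : Additive H → Submodule k A) {F : H → H → kˣ} (_ : IsTwoCocycle F) : Type v := A

variable {F : H → H → kˣ} (hF : IsTwoCocycle F)

instance : AddCommGroup (Cotwist 𝒜 hF) := inferInstanceAs (AddCommGroup A)

instance : Module k (Cotwist 𝒜 hF) := inferInstanceAs (Module k A)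

/-- The identity map from `A` to its cotwist, as a linear isomorphism. -/
def toCotwist : A ≃ₗ[k] Cotwist 𝒜 hF := LinearEquiv.refl k A

noncomputable instance : Ring (Cotwist 𝒜 hF) :=
  { (inferInstance : AddCommGroup (Cotwist 𝒜 hF)) with
    mul := fun f g => toCotwist 𝒜 hF
      (bullet 𝒜 F ((toCotwist 𝒜 hF).symm f) ((toCotwist 𝒜 hF).symm g))
    one := toCotwist 𝒜 hF 1
    mul_assoc := fun f g h => bullet_assoc (A := A) 𝒜 hF f g h
    one_mul := fun f => one_bullet (A := A) 𝒜 hF f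
    mul_one := fun f => bullet_one (A := A) 𝒜 hF f
    left_distrib := fun f g h => map_add (bullet 𝒜 F (f : A)) g h
    right_distrib := fun f g h => LinearMap.map_add₂ (bullet 𝒜 F) (f : A) g h
    zero_mul := fun f => LinearMap.map_zero₂ (bullet 𝒜 F) (f : A)
    mul_zero := fun f => map_zero (bullet 𝒜 F (f : A)) }

noncomputable instance : Algebra k (Cotwist 𝒜 hF) :=
  Algebra.ofModule
    (fun c f g => LinearMap.map_smul₂ (bullet 𝒜 F) c (f : A) g)
    (fun c f g => map_smul (bullet 𝒜 F (f : A)) c g)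

theorem toCotwist_mul_toCotwist (f g : A) :
    toCotwist 𝒜 hF f * toCotwist 𝒜 hF g = toCotwist 𝒜 hF (bullet 𝒜 F f g) := rfl

theorem toCotwist_one : toCotwist 𝒜 hF 1 = 1 := rfl

end Cotwist

/-- The grading of the symmetric algebra of `V` induced by a grading of `V` by a (commutative)
group `H`: degree `a` is spanned by the products `v₁ ⋯ vₙ` (`n ≥ 0`) of homogeneous elements of `V`
of degrees `h₁, …, hₙ` with `h₁ ⋯ hₙ = a`. -/
def inducedGrading {k : Type u} {V : Type v} {H : Type w} [Field k] [AddCommGroup V] [Module k V]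
    [Group H] (𝒱 : H → Submodule k V) (a : Additive H) : Submodule k (SymmetricAlgebra k V) :=
  Submodule.span k {p | ∃ l : List (Σ h : H, 𝒱 h),
    (l.map fun q => q.1).prod = a.toMul ∧
    p = (l.map fun q => SymmetricAlgebra.ι k V q.2).prod}

/-! ## The algebras attached to a linear and to a set-theoretic solution -/

/-- The relations `v ⊗ w = R (v ⊗ w)` in the tensor algebra. -/
inductive QuantumSpaceRel {k : Type u} {V : Type v} [Field k] [AddCommGroup V] [Module k V]
    (R : V ⊗[k] V →ₗ[k] V ⊗[k] V) : TensorAlgebra k V → TensorAlgebra k V → Prop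
  | rel (t : V ⊗[k] V) : QuantumSpaceRel R
      (LinearMap.mul' k _ (TensorProduct.map (TensorAlgebra.ι k) (TensorAlgebra.ι k) t))
      (LinearMap.mul' k _ (TensorProduct.map (TensorAlgebra.ι k) (TensorAlgebra.ι k) (R t)))

/-- `k_R[V]`: the tensor algebra of `V` modulo the two-sided ideal generated by the image of
`id - R`. -/
abbrev QuantumSpace {k : Type u} {V : Type v} [Field k] [AddCommGroup V] [Module k V]
    (R : V ⊗[k] V →ₗ[k] V ⊗[k] V) : Type (max u v) := RingQuot (QuantumSpaceRel R)

/-- The canonical map `V → k_R[V]`. -/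
noncomputable def QuantumSpace.ι {k : Type u} {V : Type v} [Field k] [AddCommGroup V] [Module k V]
    (R : V ⊗[k] V →ₗ[k] V ⊗[k] V) : V →ₗ[k] QuantumSpace R :=
  (RingQuot.mkAlgHom k (QuantumSpaceRel R)).toLinearMap ∘ₗ TensorAlgebra.ι k

/-- The relations `xy = zt`, whenever `r (x, y) = (z, t)`, in the free algebra on `X`. -/
inductive YangBaxterRel (k : Type u) {X : Type v} [Field k] (r : X × X → X × X) :
    FreeAlgebra k X → FreeAlgebra k X → Prop
  | rel (x y : X) : YangBaxterRel k r (FreeAlgebra.ι k x * FreeAlgebra.ι k y)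
      (FreeAlgebra.ι k (r (x, y)).1 * FreeAlgebra.ι k (r (x, y)).2)

/-- The algebra `𝒜(k, X, r) = k⟨X ; xy = zt whenever r (x, y) = (z, t)⟩`. -/
abbrev YangBaxterAlgebra (k : Type u) {X : Type v} [Field k] (r : X × X → X × X) :
    Type (max u v) := RingQuot (YangBaxterRel k r)

/-- The generator of `𝒜(k, X, r)` given by `x`. -/
noncomputable def YangBaxterAlgebra.ι (k : Type u) {X : Type v} [Field k] (r : X × X → X × X)
    (x : X) : YangBaxterAlgebra k r :=
  RingQuot.mkAlgHom k (YangBaxterRel k r) (FreeAlgebra.ι k x)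

/-- The linear extension `R` of `r` to `V = kX`, that is
`R (x ⊗ y) = z ⊗ t` for `r (x, y) = (z, t)`. -/
noncomputable def linearExtension (k : Type u) {X : Type v} [Field k] (r : X × X → X × X) :
    (X →₀ k) ⊗[k] (X →₀ k) →ₗ[k] (X →₀ k) ⊗[k] (X →₀ k) :=
  (finsuppTensorFinsupp' k X X).symm.toLinearMap ∘ₗ Finsupp.lmapDomain k k r ∘ₗ
    (finsuppTensorFinsupp' k X X).toLinearMap

theorem linearExtension_single (k : Type u) {X : Type v} [Field k] (r : X × X → X × X) (x y : X) :
    linearExtension k r (Finsupp.single x 1 ⊗ₜ Finsupp.single y 1) =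
      Finsupp.single (r (x, y)).1 1 ⊗ₜ Finsupp.single (r (x, y)).2 1 := by
  simp only [linearExtension, LinearMap.comp_apply, LinearEquiv.coe_coe]
  rw [LinearEquiv.symm_apply_eq]
  simp [Finsupp.lmapDomain_apply, Finsupp.mapDomain_single]

/-! ## Set-theoretic solutions -/

/-- `r¹² = r × id` on `X × X × X`. -/
def r12 {X : Type u} (r : X × X → X × X) (p : X × X × X) : X × X × X :=
  ((r (p.1, p.2.1)).1, (r (p.1, p.2.1)).2, p.2.2)

/-- `r²³ = id × r` on `X × X × X`. -/
def r23 {X : Type u} (r : X × X → X × X) (p : X × X × X) : X × X × X := (p.1, r p.2)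

/-- A nondegenerate symmetric set: a nondegenerate involutive set-theoretic solution of the
Yang-Baxter (braid) equation.  For `r (x, y) = (ˣy, xʸ)` the left action is `ℒ_x y = ˣy` and the
right action is `ℛ_y x = xʸ`. -/
structure SymmetricSet (X : Type u) where
  r : X × X → X × X
  left_bijective : ∀ x, Function.Bijective fun y => (r (x, y)).1
  right_bijective : ∀ y, Function.Bijective fun x => (r (x, y)).2
  involutive : Function.Involutive r
  braid : ∀ p, r12 r (r23 r (r12 r p)) = r23 r (r12 r (r23 r p))

namespace SymmetricSet

variable {X : Type u} (S : SymmetricSet X)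

/-- `S` is square-free. -/
def IsSquareFree : Prop := ∀ x, S.r (x, x) = (x, x)

/-- The left action `ℒ_x`, a permutation of `X`. -/
noncomputable def L (x : X) : Equiv.Perm X := Equiv.ofBijective _ (S.left_bijective x)

/-! ### The retraction -/

/-- The equivalence relation `x ∼ y ↔ ℒ_x = ℒ_y`. -/
noncomputable def retSetoid : Setoid X := Setoid.ker S.L

theorem r_eq (x y : X) : S.r (x, y) = (S.L x y, (S.r (x, y)).2) := rfl

theorem L_L_right (x y : X) : S.L (S.L x y) (S.r (x, y)).2 = x :=
  congrArg Prod.fst (S.involutive (x, y))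

theorem L_mul_L (x y : X) : S.L (S.L x y) * S.L (S.r (x, y)).2 = S.L x * S.L y := by
  ext z
  have h := congrArg Prod.fst (S.braid (x, y, z))
  exact h

theorem L_eq_of_L_apply {x p q : X} (h : S.L (S.L x p) = S.L (S.L x q)) : S.L p = S.L q := by
  have h1 : (S.r (x, p)).2 = (S.r (x, q)).2 := by
    apply (S.L (S.L x p)).injective
    rw [S.L_L_right, h, S.L_L_right]
  have h2 := S.L_mul_L x p
  rw [h1, h, S.L_mul_L] at h2
  exact (mul_left_cancel h2).symm

theorem L_apply_eq [Finite X] (x : X) {p q : X} (h : S.L p = S.L q) :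
    S.L (S.L x p) = S.L (S.L x q) := by
  have key : ∀ (n : ℕ) (p q : X), S.L p = S.L q →
      S.L (((S.L x)⁻¹ ^ n) p) = S.L (((S.L x)⁻¹ ^ n) q) := by
    intro n
    induction n with
    | zero => intro p q h; simpa using h
    | succ n ih =>
      intro p q h
      rw [pow_succ, Equiv.Perm.mul_apply, Equiv.Perm.mul_apply]
      refine ih _ _ (S.L_eq_of_L_apply (x := x) ?_)
      simpa using h
  obtain ⟨n, hn, hn1⟩ := (isOfFinOrder_of_finite (S.L x)).exists_pow_eq_one
  obtain ⟨m, rfl⟩ := Nat.exists_eq_succ_of_ne_zero hn.ne'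
  have : S.L x = (S.L x)⁻¹ ^ m := by
    rw [inv_pow, eq_inv_iff_mul_eq_one, ← pow_succ', hn1]
  have h2 := key m p q h
  rwa [← this] at h2

theorem L_right_eq_right {x y y' : X} [Finite X] (h : S.L y = S.L y') :
    (S.r (x, y)).2 = (S.r (x, y')).2 := by
  apply (S.L (S.L x y)).injective
  rw [S.L_L_right, S.L_apply_eq x h, S.L_L_right]

theorem L_right_eq_left {x x' y : X} (h : S.L x = S.L x') :
    S.L (S.r (x, y)).2 = S.L (S.r (x', y)).2 := by
  apply S.L_eq_of_L_apply (x := S.L x y)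
  have h2 : S.L x y = S.L x' y := by rw [h]
  rw [S.L_L_right, h2, S.L_L_right, h]

/-- The map `[r]` on the set `[X]` of equivalence classes, `[r] ([x], [y]) = ([ˣy], [xʸ])`. -/
noncomputable def retMap [Finite X] (p : Quotient S.retSetoid × Quotient S.retSetoid) :
    Quotient S.retSetoid × Quotient S.retSetoid :=
  Quotient.liftOn₂ p.1 p.2
    (fun x y => (Quotient.mk S.retSetoid (S.r (x, y)).1, Quotient.mk S.retSetoid (S.r (x, y)).2))
    (by
      intro x y x' y' hx hy
      have hx : S.L x = S.L x' := hx
      have hy : S.L y = S.L y' := hy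
      refine Prod.ext (Quotient.sound ?_) (Quotient.sound ?_)
      · change S.L (S.L x y) = S.L (S.L x' y')
        rw [hx, S.L_apply_eq x' hy]
      · change S.L _ = S.L _
        rw [S.L_right_eq_left hx, S.L_right_eq_right hy])

/-- The retraction `Ret(X, r) = ([X], [r])` of a finite nondegenerate symmetric set. -/
noncomputable def ret [Finite X] : SymmetricSet (Quotient S.retSetoid) where
  r := S.retMap
  left_bijective a := by
    refine Function.Surjective.bijective_of_finite fun b => ?_
    induction a using Quotient.inductionOn with | h x =>
    induction b using Quotient.inductionOn with | h y =>
    obtain ⟨z, hz⟩ := (S.left_bijective x).2 y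
    exact ⟨Quotient.mk _ z, congrArg (Quotient.mk _) hz⟩
  right_bijective a := by
    refine Function.Surjective.bijective_of_finite fun b => ?_
    induction a using Quotient.inductionOn with | h x =>
    induction b using Quotient.inductionOn with | h y =>
    obtain ⟨z, hz⟩ := (S.right_bijective x).2 y
    exact ⟨Quotient.mk _ z, congrArg (Quotient.mk _) hz⟩
  involutive := by
    rintro ⟨a, b⟩
    induction a using Quotient.inductionOn with | h x =>
    induction b using Quotient.inductionOn with | h y =>
    exact congrArg (Prod.map (Quotient.mk S.retSetoid) (Quotient.mk S.retSetoid))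
      (S.involutive (x, y))
  braid := by
    rintro ⟨a, b, c⟩
    induction a using Quotient.inductionOn with | h x =>
    induction b using Quotient.inductionOn with | h y =>
    induction c using Quotient.inductionOn with | h z =>
    exact congrArg (Prod.map (Quotient.mk S.retSetoid)
      (Prod.map (Quotient.mk S.retSetoid) (Quotient.mk S.retSetoid))) (S.braid (x, y, z))

/-- The `m`-fold retraction `Ret^m(X, r)` is the (necessarily trivial) solution on a set of one
element. -/
def RetIsSingleton : ℕ → ∀ {X : Type u} [Finite X], SymmetricSet X → Prop
  | 0, X, _, _ => Nat.card X = 1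
  | m + 1, _, _, S => RetIsSingleton m S.ret

/-- `S` is a multipermutation solution of level `m`: `m` is the least natural number such that
`Ret^m(X, r)` is the solution on a set of one element. -/
def IsMultipermutationOfLevel [Finite X] (m : ℕ) : Prop :=
  RetIsSingleton m S ∧ ∀ l < m, ¬ RetIsSingleton l S

/-! ### Orbits, the groups `𝒢_i` and the group `H` -/

/-- The permutation group `𝒢(X, r)` of left actions, generated by all `ℒ_x`. -/
def permGroup : Subgroup (Equiv.Perm X) := Subgroup.closure (Set.range S.L)

/-- The index set of the orbits `X_i` of the left action. -/
abbrev OrbitIndex : Type u := MulAction.orbitRel.Quotient S.permGroup X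

/-- The index of the orbit that contains `x`. -/
def orbitOf (x : X) : S.OrbitIndex := Quotient.mk _ x

/-- The orbit `X_i`. -/
abbrev Orbit (i : S.OrbitIndex) : Type u := {x : X // S.orbitOf x = i}

theorem orbitOf_L (x y : X) : S.orbitOf (S.L x y) = S.orbitOf y :=
  Quotient.sound ⟨⟨S.L x, Subgroup.subset_closure ⟨x, rfl⟩⟩, rfl⟩

/-- The restriction of `ℒ_x` to the orbit `X_i`. -/
noncomputable def restrictL (i : S.OrbitIndex) (x : X) : Equiv.Perm (S.Orbit i) :=
  (S.L x).subtypePerm fun y => by rw [S.orbitOf_L]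

/-- `𝒢_i`: the subgroup of `Sym(X_i)` generated by the restrictions of all `ℒ_x` to `X_i`. -/
def orbitGroup (i : S.OrbitIndex) : Subgroup (Equiv.Perm (S.Orbit i)) :=
  Subgroup.closure (Set.range (S.restrictL i))

/-- `𝓗 = ∏ᵢ 𝒢_i`. -/
abbrev ProdGroup : Type u := ∀ i : S.OrbitIndex, S.orbitGroup i

/-- `𝓗^* = ∏ᵢ 𝒢_i^*`, where `𝒢_i^*` is the group of characters `𝒢_i → ℂˣ`. -/
abbrev ProdDual : Type u := ∀ i : S.OrbitIndex, (S.orbitGroup i →* ℂˣ)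

/-- `H = 𝓗^* × 𝓗`. -/
abbrev GradingGroup : Type u := S.ProdDual × S.ProdGroup

noncomputable instance : DecidableEq S.GradingGroup := Classical.decEq _

noncomputable instance [Finite X] : Fintype S.OrbitIndex := Fintype.ofFinite _

/-- The evaluation `χ(h) = ∏ᵢ χ_i(h_i)` of `χ ∈ 𝓗^*` at `h ∈ 𝓗`. -/
noncomputable def pairing [Finite X] (χ : S.ProdDual) (h : S.ProdGroup) : ℂˣ := ∏ i, χ i (h i)

/-- The canonical 2-cocycle on `H`, `F((χ, g), (χ', h)) = χ'(g) = ∏ᵢ χ'_i(g_i)`. -/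
noncomputable def canonicalCocycle [Finite X] (a b : S.GradingGroup) : ℂˣ := S.pairing b.1 a.2

/-! ### The grading -/

/-- The element `γ = (ℒ_x restricted to X_j)_j` of `𝓗`.  It depends only on the orbit `X_i` of
`x` if the multipermutation level is two, and then its components are the `σ^i_j`. -/
noncomputable def gamma (x : X) : S.ProdGroup := fun j =>
  ⟨S.restrictL j x, Subgroup.subset_closure ⟨x, rfl⟩⟩

/-- The action of `𝓗` on `X`: the `i`-th component acts on `X_i` (and trivially on the other
orbits). -/
def act (h : S.ProdGroup) (x : X) : X :=
  ((h (S.orbitOf x) : Equiv.Perm (S.Orbit (S.orbitOf x))) ⟨x, rfl⟩ : S.Orbit (S.orbitOf x)).1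

/-- The homogeneous component of `V = ℂX` of degree `(χ, g) ∈ 𝓗^* × 𝓗`.  The `𝓗`-grading
is the one for which `x` has degree `gamma x`, and the `𝓗^*`-grading is equivalent to the linear
action of `𝓗` on `V`: degree `χ` is the subspace on which every `h ∈ 𝓗` acts as the
scalar `χ(h)`. -/
noncomputable def grading [Finite X] (a : S.GradingGroup) : Submodule ℂ (X →₀ ℂ) :=
  Finsupp.supported ℂ ℂ {x | S.gamma x = a.2} ⊓
    ⨅ h : S.ProdGroup,
      Module.End.eigenspace (Finsupp.lmapDomain ℂ ℂ (S.act h)) (S.pairing a.1 h : ℂ)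

/-- The induced `H`-grading on the polynomial algebra `ℂ[V]`, i.e. the symmetric algebra of `V`. -/
noncomputable abbrev polynomialGrading [Finite X] :
    Additive S.GradingGroup → Submodule ℂ (SymmetricAlgebra ℂ (X →₀ ℂ)) :=
  inducedGrading S.grading

end SymmetricSet

/-! In `Ret(X, r)` all left actions coincide, so each acts on a class `[y]` as `[y]` itself does,
which by square-freeness fixes `[y]`. Hence `ℒ_{ˣy} = ℒ_y` (`L_L_of_level_two`), and everything
after that uses only this identity: `ℒ` is constant on orbits, all `ℒ_x` commute, and `r (x, y) =
(ℒ_x y, ℒ_y⁻¹ x)`. The groups `𝒢_i` are then finite abelian, so `V` splits into simultaneous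
eigenspaces of `𝓗`, and the grading of `V` extends to `ℂ[V]`.

The cocycle evaluates the character of the right factor at the `γ` of the left one, which is the
eigenvalue of `γ` there. So `x • p = x · (ℒ_x p)`, with `ℒ_x` acting by an algebra automorphism
(`bullet_ι`). In particular `x • y = x · ℒ_x y` and `ˣy • xʸ = ℒ_x y · ℒ_y (ℒ_y⁻¹ x) = ℒ_x y · x`,
which agree in the commutative algebra. This gives a map from `𝒜(ℂ, X, r)` to the cotwist. It sends
words to commutative monomials. The inverse `untwist` undoes the accumulated permutations letter by
letter; it does not depend on the order of the monomial, because a swap of neighbours becomes a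
defining relation (`untwist_perm`). -/

section InducedGrading

/-! ### The grading induced on a symmetric algebra -/

variable {k : Type u} {V : Type v} {H : Type w} [Field k] [AddCommGroup V] [Module k V]

theorem ι_mem_inducedGrading [Group H] (𝒱 : H → Submodule k V) {a : H} {v : V} (hv : v ∈ 𝒱 a) :
    SymmetricAlgebra.ι k V v ∈ inducedGrading 𝒱 (Additive.ofMul a) :=
  Submodule.subset_span ⟨[⟨a, v, hv⟩], by simp, by simp⟩

instance inducedGrading.gradedMonoid [Group H] (𝒱 : H → Submodule k V) :
    SetLike.GradedMonoid (inducedGrading 𝒱) where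
  one_mem := Submodule.subset_span ⟨[], by simp, by simp⟩
  mul_mem := by
    intro a b p q hp hq
    have h := Submodule.mul_mem_mul hp hq
    rw [inducedGrading, inducedGrading, Submodule.span_mul_span] at h
    refine Submodule.span_mono ?_ h
    rintro _ ⟨_, ⟨l, hl, rfl⟩, _, ⟨l', hl', rfl⟩, rfl⟩
    exact ⟨l ++ l', by simp [hl, hl'], by simp⟩

/-- The map from `V` to the direct sum of the components of the induced grading. -/
noncomputable def inducedGrading.decomposeι [CommGroup H] [DecidableEq H] (𝒱 : H → Submodule k V)
    [DirectSum.Decomposition 𝒱] :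
    V →ₗ[k] DirectSum (Additive H) fun a => inducedGrading 𝒱 a :=
  (DirectSum.toModule k H (DirectSum (Additive H) fun a => inducedGrading 𝒱 a) fun a =>
      DirectSum.lof k (Additive H) (fun a => inducedGrading 𝒱 a) (Additive.ofMul a) ∘ₗ
        (SymmetricAlgebra.ι k V).restrict fun _ hv => ι_mem_inducedGrading 𝒱 hv) ∘ₗ
    (DirectSum.decomposeLinearEquiv 𝒱).toLinearMap

theorem inducedGrading.decomposeι_of_mem [CommGroup H] [DecidableEq H] (𝒱 : H → Submodule k V)
    [DirectSum.Decomposition 𝒱] {a : H} {v : V} (hv : v ∈ 𝒱 a) :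
    inducedGrading.decomposeι 𝒱 v = DirectSum.of (fun a => inducedGrading 𝒱 a) (Additive.ofMul a)
      ⟨SymmetricAlgebra.ι k V v, ι_mem_inducedGrading 𝒱 hv⟩ := by
  lift v to 𝒱 a using hv
  simp only [decomposeι, LinearMap.comp_apply, LinearEquiv.coe_coe,
    DirectSum.decomposeLinearEquiv_apply, DirectSum.decompose_coe, ← DirectSum.lof_eq_of k,
    DirectSum.toModule_lof]
  rfl

/-- The grading of the symmetric algebra induced by a grading by a commutative group. -/
noncomputable abbrev inducedGrading.gradedAlgebra [CommGroup H] [DecidableEq H]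
    (𝒱 : H → Submodule k V) [DirectSum.Decomposition 𝒱] :
    GradedAlgebra (inducedGrading 𝒱) :=
  GradedAlgebra.ofAlgHom _ (SymmetricAlgebra.lift (inducedGrading.decomposeι 𝒱))
    (by
      ext v
      change DirectSum.coeAlgHom _ (SymmetricAlgebra.lift (inducedGrading.decomposeι 𝒱)
        (SymmetricAlgebra.ι k V v)) = SymmetricAlgebra.ι k V v
      rw [SymmetricAlgebra.lift_ι_apply]
      induction v using DirectSum.Decomposition.inductionOn 𝒱 with
      | zero => simp
      | add v w hv hw => simp [hv, hw]
      | @homogeneous a v => simp [decomposeι_of_mem 𝒱 v.2])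
    (by
      -- Membership and value are proved together, since the summand of the direct sum is a subtype
      -- and its degree changes along the induction.
      have key : ∀ l : List (Σ h : H, 𝒱 h),
          ∃ hp : (l.map fun q => SymmetricAlgebra.ι k V q.2).prod ∈
              inducedGrading 𝒱 (Additive.ofMul (l.map fun q => q.1).prod),
            SymmetricAlgebra.lift (inducedGrading.decomposeι 𝒱)
              (l.map fun q => SymmetricAlgebra.ι k V q.2).prod =
              DirectSum.of (fun a => inducedGrading 𝒱 a) _ ⟨_, hp⟩ := by
        intro l
        induction l with
        | nil => exact ⟨SetLike.one_mem_graded (inducedGrading 𝒱), map_one _⟩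
        | cons q l ih =>
          obtain ⟨hp, h⟩ := ih
          refine ⟨SetLike.mul_mem_graded (ι_mem_inducedGrading 𝒱 q.2.2) hp, ?_⟩
          simp only [List.map_cons, List.prod_cons, map_mul, SymmetricAlgebra.lift_ι_apply,
            decomposeι_of_mem 𝒱 q.2.2, h, DirectSum.of_mul_of]
          rfl
      rintro a ⟨p, hp⟩
      change SymmetricAlgebra.lift (inducedGrading.decomposeι 𝒱) p = _
      induction hp using Submodule.span_induction with
      | mem p h =>
        obtain ⟨l, hl, rfl⟩ := h
        obtain rfl : Additive.ofMul (l.map fun q => q.1).prod = a := hl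
        exact (key l).2
      | zero => exact (map_zero _).trans (map_zero (DirectSum.of (fun a => inducedGrading 𝒱 a) a)).symm
      | add p q hp hq h1 h2 =>
        rw [map_add, h1, h2, ← map_add]
        rfl
      | smul c p hp h =>
        rw [map_smul, h, ← DirectSum.lof_eq_of k, ← map_smul]
        rfl)

end InducedGrading

section QuantumSpace

/-! ### The two presentations, `k_R[V]` and `𝒜(k, X, r)` -/

variable (k : Type u) {X : Type v} [Field k] (r : X × X → X × X)

/-- The map `𝒜(k, X, r) → k_R[V]` that is the identity on the generators. -/
noncomputable def YangBaxterAlgebra.toQuantumSpace :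
    YangBaxterAlgebra k r →ₐ[k] QuantumSpace (linearExtension k r) :=
  RingQuot.liftAlgHom k ⟨FreeAlgebra.lift k fun x =>
      QuantumSpace.ι (linearExtension k r) (Finsupp.single x 1), by
    rintro _ _ ⟨x, y⟩
    have h := RingQuot.mkAlgHom_rel k
      (QuantumSpaceRel.rel (R := linearExtension k r) (Finsupp.single x 1 ⊗ₜ Finsupp.single y 1))
    rw [linearExtension_single] at h
    simpa [QuantumSpace.ι] using h⟩

/-- The map `k_R[V] → 𝒜(k, X, r)` that is the identity on the generators. -/
noncomputable def QuantumSpace.toYangBaxterAlgebra :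
    QuantumSpace (linearExtension k r) →ₐ[k] YangBaxterAlgebra k r :=
  RingQuot.liftAlgHom k ⟨TensorAlgebra.lift k
      (Finsupp.linearCombination k (YangBaxterAlgebra.ι k r)), by
    rintro _ _ ⟨t⟩
    -- Both sides of the relation are linear in `t`, so it suffices to compare them on basis
    -- tensors.
    let f : (X →₀ k) ⊗[k] (X →₀ k) →ₗ[k] YangBaxterAlgebra k r :=
      (TensorAlgebra.lift k (Finsupp.linearCombination k (YangBaxterAlgebra.ι k r))).toLinearMap ∘ₗ
        LinearMap.mul' k _ ∘ₗ TensorProduct.map (TensorAlgebra.ι k) (TensorAlgebra.ι k)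
    have h : f = f ∘ₗ linearExtension k r := by
      ext x y
      have := RingQuot.mkAlgHom_rel k (YangBaxterRel.rel (k := k) (r := r) x y)
      simpa [f, linearExtension_single, YangBaxterAlgebra.ι] using this
    exact LinearMap.congr_fun h t⟩

@[simp]
theorem YangBaxterAlgebra.toQuantumSpace_ι (x : X) :
    YangBaxterAlgebra.toQuantumSpace k r (YangBaxterAlgebra.ι k r x) =
      QuantumSpace.ι (linearExtension k r) (Finsupp.single x 1) := by
  simp [toQuantumSpace, YangBaxterAlgebra.ι]

@[simp]
theorem QuantumSpace.toYangBaxterAlgebra_ι (v : X →₀ k) :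
    QuantumSpace.toYangBaxterAlgebra k r (QuantumSpace.ι (linearExtension k r) v) =
      Finsupp.linearCombination k (YangBaxterAlgebra.ι k r) v := by
  simp [toYangBaxterAlgebra, QuantumSpace.ι]

/-- `𝒜(k, X, r)` is isomorphic to `k_R[V]`, where `R` is the linear extension of `r`. -/
noncomputable def YangBaxterAlgebra.equivQuantumSpace :
    YangBaxterAlgebra k r ≃ₐ[k] QuantumSpace (linearExtension k r) :=
  AlgEquiv.ofAlgHom (YangBaxterAlgebra.toQuantumSpace k r) (QuantumSpace.toYangBaxterAlgebra k r)
    (by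
      apply RingQuot.ringQuot_ext'
      ext x
      change toQuantumSpace k r (QuantumSpace.toYangBaxterAlgebra k r
        (QuantumSpace.ι (linearExtension k r) (Finsupp.single x 1))) =
          QuantumSpace.ι (linearExtension k r) (Finsupp.single x 1)
      simp)
    (by
      apply RingQuot.ringQuot_ext'
      ext x
      change QuantumSpace.toYangBaxterAlgebra k r (toQuantumSpace k r (YangBaxterAlgebra.ι k r x)) =
        YangBaxterAlgebra.ι k r x
      simp)

end QuantumSpace

namespace SymmetricSet

/-! ### Consequences of multipermutation level two -/

variable {X : Type u} (S : SymmetricSet X)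

/-- Since `Ret²` is a point, `[x]` and `[y]` act alike on `Ret`; compare their values at `[y]`,
where `ʸy = y`. -/
theorem L_L_of_level_two [Finite X] (hsf : S.IsSquareFree) (hlevel : S.IsMultipermutationOfLevel 2)
    (x y : X) : S.L (S.L x y) = S.L y := by
  have h : Nat.card (Quotient S.ret.retSetoid) = 1 := hlevel.1
  have := (Nat.card_eq_one_iff_unique.1 h).1
  have key : S.ret.L (Quotient.mk _ x) = S.ret.L (Quotient.mk _ y) :=
    Quotient.exact (Subsingleton.elim (Quotient.mk S.ret.retSetoid (Quotient.mk _ x))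
      (Quotient.mk S.ret.retSetoid (Quotient.mk _ y)))
  have h1 : Quotient.mk S.retSetoid (S.L x y) = Quotient.mk S.retSetoid (S.L y y) :=
    congrArg (fun σ => σ (Quotient.mk S.retSetoid y)) key
  have h2 : S.L y y = y := congrArg Prod.fst (hsf y)
  rw [h2] at h1
  exact Quotient.exact h1

variable {S}

section Level

variable (hL : ∀ x y, S.L (S.L x y) = S.L y)
include hL

theorem L_apply_of_mem_permGroup {σ : Equiv.Perm X} (hσ : σ ∈ S.permGroup) (y : X) :
    S.L (σ y) = S.L y := by
  induction hσ using Subgroup.closure_induction generalizing y with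
  | mem σ h => obtain ⟨x, rfl⟩ := h; exact hL x y
  | one => rfl
  | mul σ τ _ _ h1 h2 => rw [Equiv.Perm.mul_apply, h1, h2]
  | inv σ _ h => rw [← h (σ⁻¹ y)]; simp

theorem L_eq_of_orbitOf_eq {x y : X} (h : S.orbitOf x = S.orbitOf y) : S.L x = S.L y := by
  obtain ⟨σ, rfl⟩ : x ∈ MulAction.orbit S.permGroup y := Quotient.exact h
  exact L_apply_of_mem_permGroup hL σ.2 y

theorem gamma_eq_of_orbitOf_eq {x y : X} (h : S.orbitOf x = S.orbitOf y) :
    S.gamma x = S.gamma y := by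
  funext i
  refine Subtype.ext (Equiv.ext fun z => Subtype.ext ?_)
  exact congrArg (fun σ : Equiv.Perm X => σ z.1) (L_eq_of_orbitOf_eq hL h)

/-- Involutivity reads `ℒ_{ˣy} (xʸ) = x`, and here `ℒ_{ˣy} = ℒ_y`. -/
theorem r_snd_eq (x y : X) : (S.r (x, y)).2 = (S.L y)⁻¹ x := by
  have h := S.L_L_right x y
  rw [hL] at h
  rw [Equiv.Perm.eq_inv_iff_eq, h]

theorem L_inv_apply (x y : X) : S.L ((S.L x)⁻¹ y) = S.L y :=
  L_apply_of_mem_permGroup hL (inv_mem (Subgroup.subset_closure ⟨x, rfl⟩)) y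

/-- The braid relation gives `ℒ_{ˣy} ℒ_{xʸ} = ℒ_x ℒ_y`, and the left side collapses to `ℒ_y ℒ_x`. -/
theorem L_commute (x y : X) : Commute (S.L x) (S.L y) := by
  have h := S.L_mul_L x y
  rw [hL, r_snd_eq hL, L_inv_apply hL] at h
  exact h.symm

theorem commute_L_of_mem_permGroup {σ : Equiv.Perm X} (hσ : σ ∈ S.permGroup) (x : X) :
    Commute σ (S.L x) := by
  induction hσ using Subgroup.closure_induction with
  | mem σ h => obtain ⟨y, rfl⟩ := h; exact L_commute hL y x
  | one => exact Commute.one_left _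
  | mul σ τ _ _ h1 h2 => exact h1.mul_left h2
  | inv σ _ h => exact h.inv_left

theorem orbitGroup_mul_comm (i : S.OrbitIndex) (a b : S.orbitGroup i) : a * b = b * a := by
  refine (Subgroup.isMulCommutative_closure (k := Set.range (S.restrictL i)) ?_).is_comm.comm a b
  rintro _ ⟨x, rfl⟩ _ ⟨y, rfl⟩
  exact Equiv.ext fun z => Subtype.ext
    (congrArg (fun σ : Equiv.Perm X => σ z.1) (L_commute hL x y))

theorem prodGroup_mul_comm (a b : S.ProdGroup) : a * b = b * a :=
  funext fun i => orbitGroup_mul_comm hL i (a i) (b i)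

theorem gradingGroup_mul_comm (a b : S.GradingGroup) : a * b = b * a :=
  Prod.ext (funext fun i => mul_comm (a.1 i) (b.1 i)) (prodGroup_mul_comm hL _ _)

end Level

/-! ### The action of `𝓗` -/

theorem act_eq (h : S.ProdGroup) {i : S.OrbitIndex} (x : S.Orbit i) :
    S.act h x = (h i : Equiv.Perm (S.Orbit i)) x := by
  obtain ⟨x, rfl⟩ := x
  rfl

theorem orbitOf_act (h : S.ProdGroup) (x : X) : S.orbitOf (S.act h x) = S.orbitOf x :=
  ((h (S.orbitOf x) : Equiv.Perm (S.Orbit (S.orbitOf x))) ⟨x, rfl⟩).2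

theorem act_mul (g h : S.ProdGroup) (x : X) : S.act (g * h) x = S.act g (S.act h x) :=
  (act_eq g ((h (S.orbitOf x) : Equiv.Perm (S.Orbit (S.orbitOf x))) ⟨x, rfl⟩)).symm

theorem act_one (x : X) : S.act 1 x = x := rfl

theorem act_gamma (x y : X) : S.act (S.gamma x) y = S.L x y := rfl

/-! ### Characters of `𝓗` -/

variable [Finite X]

theorem pairing_mul_right (χ : S.ProdDual) (g h : S.ProdGroup) :
    S.pairing χ (g * h) = S.pairing χ g * S.pairing χ h := by
  simp [pairing, Finset.prod_mul_distrib]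

theorem pairing_mul_left (χ ψ : S.ProdDual) (h : S.ProdGroup) :
    S.pairing (χ * ψ) h = S.pairing χ h * S.pairing ψ h := by
  simp [pairing, Finset.prod_mul_distrib]

theorem pairing_one_right (χ : S.ProdDual) : S.pairing χ 1 = 1 := by
  simp [pairing]

theorem pairing_one_left (h : S.ProdGroup) : S.pairing 1 h = 1 := by
  simp [pairing]

theorem pairing_mulSingle [DecidableEq S.OrbitIndex] (χ : S.ProdDual) (i : S.OrbitIndex)
    (g : S.orbitGroup i) :
    S.pairing χ (Pi.mulSingle i g) = χ i g := by
  rw [pairing, Finset.prod_eq_single i]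
  · simp
  · intro j _ hj
    simp [Pi.mulSingle_eq_of_ne hj]
  · simp

/-- A character of a finite product is the product of its restrictions to the factors. -/
theorem exists_pairing_eq (f : S.ProdGroup →* ℂˣ) : ∃ χ : S.ProdDual, ∀ h, S.pairing χ h = f h := by
  classical
  refine ⟨fun i => f.comp (MonoidHom.mulSingle (fun i => S.orbitGroup i) i), ?_⟩
  let p : S.ProdGroup →* ℂˣ :=
    { toFun := S.pairing fun i => f.comp (MonoidHom.mulSingle (fun i => S.orbitGroup i) i)
      map_one' := pairing_one_right _
      map_mul' := pairing_mul_right _ }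
  refine DFunLike.congr_fun (f := p) (MonoidHom.pi_ext fun i g => ?_)
  exact pairing_mulSingle _ i g

theorem sum_pairing_eq_zero [Fintype S.ProdGroup] {χ : S.ProdDual} (hχ : χ ≠ 1) :
    ∑ h, (S.pairing χ h : ℂ) = 0 := by
  classical
  let p : S.ProdGroup →* ℂ :=
    (Units.coeHom ℂ).comp
    { toFun := S.pairing χ
      map_one' := pairing_one_right _
      map_mul' := pairing_mul_right _ }
  refine sum_hom_units_eq_zero p fun hp => hχ ?_
  funext i
  ext g
  rw [← pairing_mulSingle]
  exact DFunLike.congr_fun hp _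

theorem isTwoCocycle_canonicalCocycle : IsTwoCocycle S.canonicalCocycle where
  cocycle a b c := by
    simp only [canonicalCocycle, Prod.fst_mul, Prod.snd_mul, pairing_mul_left, pairing_mul_right]
    exact mul_assoc _ _ _
  one_left a := pairing_one_right _

variable {X : Type u} {S : SymmetricSet X} [Finite X]

/-! ### The decomposition of `V` into homogeneous components -/

theorem mem_grading {a : S.GradingGroup} {v : X →₀ ℂ} :
    v ∈ S.grading a ↔ v ∈ Finsupp.supported ℂ ℂ {x | S.gamma x = a.2} ∧
      ∀ h, Finsupp.lmapDomain ℂ ℂ (S.act h) v = (S.pairing a.1 h : ℂ) • v := by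
  simp [grading]

theorem pairing_inv_left (χ : S.ProdDual) (h : S.ProdGroup) :
    S.pairing χ⁻¹ h = (S.pairing χ h)⁻¹ := by
  simp [pairing]

/-- The projection onto the homogeneous component of degree `a` along the others. -/
noncomputable def gradingProj [Fintype S.ProdGroup] (a : S.GradingGroup) :
    Module.End ℂ (X →₀ ℂ) :=
  (∑ h : S.ProdGroup, ((S.pairing a.1 h)⁻¹ : ℂˣ).val • Finsupp.lmapDomain ℂ ℂ (S.act h)) ∘ₗ
    (Finsupp.supported ℂ ℂ {x | S.gamma x = a.2}).subtype ∘ₗ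
      (open scoped Classical in Finsupp.restrictDom ℂ ℂ {x | S.gamma x = a.2})

/-- Different `𝓗`-degrees have disjoint supports; different characters are separated by
orthogonality. The averaging sum is not normalised, whence the factor `|𝓗|`. -/
theorem gradingProj_of_mem [Fintype S.ProdGroup] {a b : S.GradingGroup} {v : X →₀ ℂ}
    (hv : v ∈ S.grading b) :
    gradingProj a v = if a = b then (Fintype.card S.ProdGroup : ℂ) • v else 0 := by
  classical
  obtain ⟨hv1, hv2⟩ := mem_grading.1 hv
  by_cases hg : a.2 = b.2
  · have h1 : ((Finsupp.restrictDom ℂ ℂ {x | S.gamma x = a.2} v : _) : X →₀ ℂ) = v := by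
      rw [Finsupp.restrictDom_apply, Finsupp.filter_eq_self_iff]
      intro x hx
      rw [hg]
      exact hv1 (Finsupp.mem_support_iff.2 hx)
    have h2 : gradingProj a v = (∑ h, (S.pairing (a.1⁻¹ * b.1) h : ℂ)) • v := by
      simp only [gradingProj, LinearMap.comp_apply, Submodule.subtype_apply]
      rw [h1, LinearMap.sum_apply, Finset.sum_smul]
      refine Finset.sum_congr rfl fun h _ => ?_
      rw [LinearMap.smul_apply, hv2, smul_smul, pairing_mul_left, pairing_inv_left,
        Units.val_mul]
    rw [h2]
    split_ifs with hab
    · have h3 : a.1⁻¹ * b.1 = 1 := by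
        rw [hab]
        exact inv_mul_cancel (G := S.ProdDual) b.1
      rw [h3]
      simp [pairing_one_left]
    · rw [sum_pairing_eq_zero, zero_smul]
      intro h
      exact hab (Prod.ext (inv_mul_eq_one.1 h) hg)
  · have h1 : ((Finsupp.restrictDom ℂ ℂ {x | S.gamma x = a.2} v : _) : X →₀ ℂ) = 0 := by
      rw [Finsupp.restrictDom_apply, Finsupp.filter_eq_zero_iff]
      intro x hx
      by_contra h
      exact hg (hx.symm.trans (hv1 (Finsupp.mem_support_iff.2 h)))
    rw [if_neg fun h => hg (congrArg Prod.snd h)]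
    simp only [gradingProj, LinearMap.comp_apply, Submodule.subtype_apply]
    rw [h1, map_zero]

theorem iSupIndep_grading : iSupIndep S.grading := by
  have := Fintype.ofFinite S.ProdGroup
  intro a
  rw [Submodule.disjoint_def]
  intro v hv hv'
  have h : (⨆ b, ⨆ (_ : b ≠ a), S.grading b) ≤ LinearMap.ker (gradingProj a) := by
    refine iSup₂_le fun b hb w hw => ?_
    rw [LinearMap.mem_ker, gradingProj_of_mem hw, if_neg hb.symm]
  have h1 : gradingProj a v = 0 := h hv'
  rw [gradingProj_of_mem hv, if_pos rfl] at h1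
  exact (smul_eq_zero.1 h1).resolve_left (Nat.cast_ne_zero.2 Fintype.card_ne_zero)

/-- Fourier inversion on the finite abelian group `𝓗`. That only degrees with second component `γ_x`
are needed is what `bullet_ι` relies on. -/
theorem single_mem_iSup_grading (hL : ∀ x y, S.L (S.L x y) = S.L y) (x : X) :
    Finsupp.single x (1 : ℂ) ∈ ⨆ χ, S.grading (χ, S.gamma x) := by
  classical
  have := Fintype.ofFinite S.ProdGroup
  let : CommGroup S.ProdGroup := { mul_comm := prodGroup_mul_comm hL }
  have hchar : ∀ ψ : AddChar (Additive S.ProdGroup) ℂ, ∃ χ : S.ProdDual,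
      ∀ h, (S.pairing χ h : ℂ) = ψ (Additive.ofMul h) := fun ψ => by
    obtain ⟨χ, hχ⟩ := exists_pairing_eq (S := S)
      (MonoidHom.toHomUnits (G := S.ProdGroup) (M := ℂ)
        { toFun := fun h => ψ (Additive.ofMul h)
          map_one' := AddChar.map_zero_eq_one ψ
          map_mul' := fun g h => AddChar.map_add_eq_mul ψ _ _ })
    exact ⟨χ, fun h => by rw [hχ]; rfl⟩
  choose χ hχ using hchar
  -- For fixed `h` the sum of `ψ(h)` over all characters vanishes unless `h = 1`. For fixed `ψ` the
  -- inner sum is an eigenvector of character `ψ`.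
  have key : (Fintype.card S.ProdGroup : ℂ) • Finsupp.single x (1 : ℂ) =
      ∑ ψ : AddChar (Additive S.ProdGroup) ℂ, ∑ h : S.ProdGroup,
        ψ (Additive.ofMul h) • Finsupp.single (S.act h⁻¹ x) (1 : ℂ) := by
    rw [Finset.sum_comm]
    simp only [← Finset.sum_smul]
    rw [Finset.sum_eq_single 1]
    · rw [AddChar.sum_apply_eq_ite, if_pos (show Additive.ofMul (1 : S.ProdGroup) = 0 from rfl), inv_one,
        act_one, Fintype.card_additive]
    · intro h _ hh
      rw [AddChar.sum_apply_eq_ite, if_neg (show ¬ Additive.ofMul h = 0 from hh), zero_smul]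
    · simp
  have hc : (Fintype.card S.ProdGroup : ℂ) ≠ 0 := Nat.cast_ne_zero.2 Fintype.card_ne_zero
  rw [← Submodule.smul_mem_iff _ hc, key]
  refine Submodule.sum_mem _ fun ψ _ => Submodule.mem_iSup_of_mem (χ ψ) (mem_grading.2 ⟨?_, ?_⟩)
  · refine Submodule.sum_mem _ fun h _ => Submodule.smul_mem _ _ ?_
    exact Finsupp.single_mem_supported ℂ _ (gamma_eq_of_orbitOf_eq hL (orbitOf_act _ _))
  · intro g
    rw [map_sum, hχ, Finset.smul_sum]
    -- With `h' = h g⁻¹` one has `g h⁻¹ = h'⁻¹` and `ψ(h) = ψ(g) ψ(h')`.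
    refine Fintype.sum_equiv (Equiv.mulRight g⁻¹) _ _ fun h => ?_
    rw [map_smul, Finsupp.lmapDomain_apply, Finsupp.mapDomain_single, ← act_mul, smul_smul]
    congr 2
    · rw [← AddChar.map_add_eq_mul, ← ofMul_mul]
      congr 2
      simp

theorem iSup_grading_eq_top (hL : ∀ x y, S.L (S.L x y) = S.L y) : ⨆ a, S.grading a = ⊤ := by
  rw [eq_top_iff, ← (Finsupp.basisSingleOne (R := ℂ) (ι := X)).span_eq, Submodule.span_le]
  rintro _ ⟨x, rfl⟩
  rw [Finsupp.coe_basisSingleOne]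
  exact iSup_le (fun χ => le_iSup S.grading (χ, S.gamma x)) (single_mem_iSup_grading hL x)

theorem isInternal_grading (hL : ∀ x y, S.L (S.L x y) = S.L y) :
    DirectSum.IsInternal S.grading :=
  (DirectSum.isInternal_submodule_iff_iSupIndep_and_iSup_eq_top _).2
    ⟨iSupIndep_grading, iSup_grading_eq_top hL⟩

/-- The induced grading of `ℂ[V]` as a graded algebra. -/
theorem nonempty_gradedAlgebra (hL : ∀ x y, S.L (S.L x y) = S.L y) :
    Nonempty (GradedAlgebra S.polynomialGrading) := by
  let : CommGroup S.GradingGroup := { mul_comm := gradingGroup_mul_comm hL }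
  let := (isInternal_grading hL).chooseDecomposition
  exact ⟨inducedGrading.gradedAlgebra S.grading⟩

variable {X : Type u} {S : SymmetricSet X}

/-! ### From commutative monomials to words in `𝒜(ℂ, X, r)` -/

theorem yangBaxterAlgebra_ι_mul_ι (x y : X) :
    YangBaxterAlgebra.ι ℂ S.r x * YangBaxterAlgebra.ι ℂ S.r y =
      YangBaxterAlgebra.ι ℂ S.r (S.r (x, y)).1 * YangBaxterAlgebra.ι ℂ S.r (S.r (x, y)).2 := by
  simpa [YangBaxterAlgebra.ι] using
    RingQuot.mkAlgHom_rel ℂ (YangBaxterRel.rel (k := ℂ) (r := S.r) x y)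

/-- The element of `𝒜(ℂ, X, r)` that corresponds to the commutative monomial `σ x₁ ⋯ σ xₙ`. -/
noncomputable def untwist (S : SymmetricSet X) (σ : Equiv.Perm X) :
    List X → YangBaxterAlgebra ℂ S.r
  | [] => 1
  | x :: l => YangBaxterAlgebra.ι ℂ S.r (σ x) * untwist S (σ * (S.L x)⁻¹) l

section Level

variable (hL : ∀ x y, S.L (S.L x y) = S.L y)
include hL

omit hL in
theorem L_mem_permGroup (x : X) : S.L x ∈ S.permGroup := Subgroup.subset_closure ⟨x, rfl⟩

/-- The swap case is the relation `r (σ y, σ ℒ_y⁻¹ x) = (σ x, σ ℒ_x⁻¹ y)`; the tails agree because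
`ℒ_x` and `ℒ_y` commute. -/
theorem untwist_perm {l l' : List X} (h : l.Perm l') {σ : Equiv.Perm X} (hσ : σ ∈ S.permGroup) :
    S.untwist σ l = S.untwist σ l' := by
  induction h generalizing σ with
  | nil => rfl
  | cons x _ ih =>
    rw [untwist, untwist, ih (mul_mem hσ (inv_mem (L_mem_permGroup x)))]
  | swap x y l =>
    have h1 := commute_L_of_mem_permGroup hL hσ y
    have h2 := L_commute hL x y
    have e1 : (S.r (σ y, (σ * (S.L y)⁻¹) x)).1 = σ x := by
      change S.L (σ y) ((σ * (S.L y)⁻¹) x) = σ x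
      rw [L_apply_of_mem_permGroup hL hσ, ← Equiv.Perm.mul_apply, h1.inv_right.eq,
        mul_inv_cancel_left]
    have e2 : (S.r (σ y, (σ * (S.L y)⁻¹) x)).2 = (σ * (S.L x)⁻¹) y := by
      rw [r_snd_eq hL, L_apply_of_mem_permGroup hL
        (mul_mem hσ (inv_mem (L_mem_permGroup y))), ← Equiv.Perm.mul_apply,
        (commute_L_of_mem_permGroup hL hσ x).inv_right.eq]
    simp only [untwist]
    rw [← mul_assoc, ← mul_assoc, yangBaxterAlgebra_ι_mul_ι, e1, e2, mul_assoc σ, mul_assoc σ,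
      h2.inv_inv.eq]
  | trans _ _ h1 h2 => rw [h1 hσ, h2 hσ]

/-- A permutation of the letters can be moved into `σ`, as `ℒ_{τ x} = ℒ_x` commutes with `τ`. -/
theorem untwist_map {τ : Equiv.Perm X} (hτ : τ ∈ S.permGroup) (σ : Equiv.Perm X) (l : List X) :
    S.untwist (σ * τ⁻¹) (l.map τ) = S.untwist σ l := by
  induction l generalizing σ with
  | nil => rfl
  | cons x l ih =>
    rw [List.map_cons, untwist, untwist, L_apply_of_mem_permGroup hL hτ, mul_assoc,
      (commute_L_of_mem_permGroup hL hτ x).inv_inv.eq, ← mul_assoc, ih]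
    simp

/-- The linear map `ℂ[V] → 𝒜(ℂ, X, r)` given by `untwist` on monomials. -/
noncomputable def untwistLinear :
    SymmetricAlgebra ℂ (X →₀ ℂ) →ₗ[ℂ] YangBaxterAlgebra ℂ S.r :=
  (Finsupp.basisSingleOne (R := ℂ) (ι := X)).symmetricAlgebra.constr ℂ fun s =>
    -- An exponent vector is a multiset, that is, a list up to permutation.
    Quot.lift (S.untwist 1) (fun _ _ h => untwist_perm hL h (one_mem _)) (Finsupp.toMultiset s)

omit hL in
theorem basis_symmetricAlgebra_toFinsupp [DecidableEq X] (l : List X) :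
    (Finsupp.basisSingleOne (R := ℂ) (ι := X)).symmetricAlgebra
      (Multiset.toFinsupp (l : Multiset X)) =
      (l.map fun x => SymmetricAlgebra.ι ℂ (X →₀ ℂ) (Finsupp.single x 1)).prod := by
  induction l with
  | nil => simp [Module.Basis.symmetricAlgebra]
  | cons x l ih =>
    rw [← Multiset.cons_coe, ← Multiset.singleton_add, map_add, List.map_cons, List.prod_cons, ← ih,
      Multiset.toFinsupp_singleton]
    simp only [Module.Basis.symmetricAlgebra, Module.Basis.map_apply,
      MvPolynomial.coe_basisMonomials]
    have h : MvPolynomial.monomial (Finsupp.single x 1 + Multiset.toFinsupp (l : Multiset X))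
        (1 : ℂ) = MvPolynomial.X x * MvPolynomial.monomial (Multiset.toFinsupp (l : Multiset X)) 1 := by
      rw [MvPolynomial.X, MvPolynomial.monomial_mul, one_mul]
    rw [h]
    have : (SymmetricAlgebra.equivMvPolynomial (Finsupp.basisSingleOne (R := ℂ) (ι := X))).symm
      (MvPolynomial.X x) = SymmetricAlgebra.ι ℂ (X →₀ ℂ) (Finsupp.single x 1) := by simp
    rw [← this]
    exact map_mul (SymmetricAlgebra.equivMvPolynomial
      (Finsupp.basisSingleOne (R := ℂ) (ι := X))).symm _ _

theorem untwistLinear_prod (l : List X) :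
    untwistLinear hL (l.map fun x => SymmetricAlgebra.ι ℂ (X →₀ ℂ) (Finsupp.single x 1)).prod =
      S.untwist 1 l := by
  classical
  rw [← basis_symmetricAlgebra_toFinsupp, untwistLinear, Module.Basis.constr_basis,
    Multiset.toFinsupp_toMultiset]
  rfl

end Level

/-! ### The twisted product -/

variable [Finite X]

/-- The algebra automorphism of `ℂ[V]` induced by the action of `h ∈ 𝓗`. -/
noncomputable def actHom (h : S.ProdGroup) :
    SymmetricAlgebra ℂ (X →₀ ℂ) →ₐ[ℂ] SymmetricAlgebra ℂ (X →₀ ℂ) :=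
  SymmetricAlgebra.lift (SymmetricAlgebra.ι ℂ _ ∘ₗ Finsupp.lmapDomain ℂ ℂ (S.act h))

omit [Finite X] in
theorem actHom_ι (h : S.ProdGroup) (v : X →₀ ℂ) :
    actHom h (SymmetricAlgebra.ι ℂ _ v) =
      SymmetricAlgebra.ι ℂ _ (Finsupp.lmapDomain ℂ ℂ (S.act h) v) :=
  SymmetricAlgebra.lift_ι_apply _ _

/-- `h` acts by an algebra map, so eigenvalues multiply along products of homogeneous vectors. -/
theorem actHom_of_mem (h : S.ProdGroup) {a : Additive S.GradingGroup}
    {p : SymmetricAlgebra ℂ (X →₀ ℂ)} (hp : p ∈ S.polynomialGrading a) :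
    actHom h p = (S.pairing a.toMul.1 h : ℂ) • p := by
  suffices h1 : S.polynomialGrading a ≤ Module.End.eigenspace (actHom h).toLinearMap
      (S.pairing a.toMul.1 h : ℂ) from Module.End.mem_eigenspace_iff.1 (h1 hp)
  refine Submodule.span_le.2 ?_
  rintro _ ⟨l, hl, rfl⟩
  rw [← hl]
  clear hl
  rw [SetLike.mem_coe, Module.End.mem_eigenspace_iff]
  change actHom h _ = _
  induction l with
  | nil => simp [pairing_one_left]
  | cons q l ih =>
    simp only [List.map_cons, List.prod_cons, map_mul, ih, actHom_ι,
      (mem_grading.1 q.2.2).2 h, map_smul, Prod.fst_mul, pairing_mul_left, Units.val_mul,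
      smul_mul_smul_comm]

variable [GradedAlgebra S.polynomialGrading]

/-- The twist depends on the left factor only through its `𝓗`-degree, so it is the same for all
homogeneous parts of `x`; on `p` it is the eigenvalue of `γ_x`. -/
theorem bullet_ι (hL : ∀ x y, S.L (S.L x y) = S.L y) (x : X)
    (p : SymmetricAlgebra ℂ (X →₀ ℂ)) :
    bullet S.polynomialGrading S.canonicalCocycle
        (SymmetricAlgebra.ι ℂ _ (Finsupp.single x 1)) p =
      SymmetricAlgebra.ι ℂ _ (Finsupp.single x 1) * actHom (S.gamma x) p := by
  induction p using DirectSum.Decomposition.inductionOn S.polynomialGrading with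
  | zero => simp
  | add p q hp hq => rw [map_add, map_add, mul_add, hp, hq]
  | @homogeneous a p =>
    rw [actHom_of_mem _ p.2]
    have hx := single_mem_iSup_grading hL x
    generalize Finsupp.single x (1 : ℂ) = v at hx ⊢
    induction hx using Submodule.iSup_induction' with
    | mem χ v hv =>
      rw [bullet_of_mem _ _ (ι_mem_inducedGrading S.grading hv) p.2, mul_smul_comm]
      rfl
    | zero => simp
    | add v w _ _ hv hw => rw [map_add, map_add, LinearMap.add_apply, hv, hw, add_mul]

variable (hF : IsTwoCocycle S.canonicalCocycle)

/-- The element `x` of the cotwist. -/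
noncomputable def cotwistι (x : X) : Cotwist S.polynomialGrading hF :=
  toCotwist S.polynomialGrading hF (SymmetricAlgebra.ι ℂ _ (Finsupp.single x 1))

theorem cotwistι_mul_prod (hL : ∀ x y, S.L (S.L x y) = S.L y) (x : X) (l : List X) :
    cotwistι hF x * toCotwist S.polynomialGrading hF
        (l.map fun y => SymmetricAlgebra.ι ℂ (X →₀ ℂ) (Finsupp.single y 1)).prod =
      toCotwist S.polynomialGrading hF
        ((x :: l.map (S.L x)).map fun y =>
          SymmetricAlgebra.ι ℂ (X →₀ ℂ) (Finsupp.single y 1)).prod := by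
  rw [cotwistι, toCotwist_mul_toCotwist, bullet_ι hL, map_list_prod, List.map_cons, List.prod_cons,
    List.map_map, List.map_map]
  congr 4
  funext y
  simp [actHom_ι, act_gamma]

/-- The algebra map `𝒜(ℂ, X, r) → ℂ[V]^F` that is the identity on the generators. -/
noncomputable def toCotwistHom (hL : ∀ x y, S.L (S.L x y) = S.L y) :
    YangBaxterAlgebra ℂ S.r →ₐ[ℂ] Cotwist S.polynomialGrading hF :=
  RingQuot.liftAlgHom ℂ ⟨FreeAlgebra.lift ℂ (cotwistι hF), by
    rintro _ _ ⟨x, y⟩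
    -- Both twisted products equal the commutative product of `x` and `ℒ_x y`.
    have h1 := cotwistι_mul_prod hF hL x [y]
    have h2 := cotwistι_mul_prod hF hL (S.r (x, y)).1 [(S.r (x, y)).2]
    have e1 : (S.r (x, y)).1 = S.L x y := rfl
    rw [r_snd_eq hL, e1, hL] at h2
    simp only [List.map_cons, List.map_nil, List.prod_cons, List.prod_nil, mul_one] at h1 h2
    simp only [map_mul, FreeAlgebra.lift_ι_apply]
    rw [r_snd_eq hL, e1]
    refine h1.trans (Eq.trans ?_ h2.symm)
    rw [mul_comm]
    simp⟩

theorem toCotwistHom_ι (hL : ∀ x y, S.L (S.L x y) = S.L y) (x : X) :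
    toCotwistHom hF hL (YangBaxterAlgebra.ι ℂ S.r x) = cotwistι hF x := by
  simp [toCotwistHom, YangBaxterAlgebra.ι]

/-- Multiplying by `σ x` on the left applies `ℒ_{σ x} = ℒ_x` to the rest, which cancels the `ℒ_x⁻¹`
that `untwist` inserted. -/
theorem toCotwistHom_untwist (hL : ∀ x y, S.L (S.L x y) = S.L y) {σ : Equiv.Perm X}
    (hσ : σ ∈ S.permGroup) (l : List X) :
    toCotwistHom hF hL (S.untwist σ l) = toCotwist S.polynomialGrading hF
      ((l.map σ).map fun y => SymmetricAlgebra.ι ℂ (X →₀ ℂ) (Finsupp.single y 1)).prod := by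
  induction l generalizing σ with
  | nil => exact map_one _
  | cons x l ih =>
    rw [untwist, map_mul, toCotwistHom_ι, ih (mul_mem hσ (inv_mem (L_mem_permGroup x))),
      cotwistι_mul_prod hF hL, L_apply_of_mem_permGroup hL hσ, List.map_map, List.map_cons]
    have h : S.L x ∘ (σ * (S.L x)⁻¹) = σ := by
      funext y
      rw [(commute_L_of_mem_permGroup hL hσ x).inv_right.eq]
      simp
    rw [h]
    rfl

/-- Carries the left-inverse identity: a word goes to a single monomial, from which `untwist`
recovers the word. -/
theorem exists_toCotwistHom_word (hL : ∀ x y, S.L (S.L x y) = S.L y) (l : List X) :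
    ∃ l' : List X,
      toCotwistHom hF hL (l.map (YangBaxterAlgebra.ι ℂ S.r)).prod = toCotwist S.polynomialGrading hF
        (l'.map fun y => SymmetricAlgebra.ι ℂ (X →₀ ℂ) (Finsupp.single y 1)).prod ∧
      S.untwist 1 l' = (l.map (YangBaxterAlgebra.ι ℂ S.r)).prod := by
  induction l with
  | nil => exact ⟨[], map_one _, rfl⟩
  | cons x l ih =>
    obtain ⟨l', h1, h2⟩ := ih
    refine ⟨x :: l'.map (S.L x), ?_, ?_⟩
    · rw [List.map_cons, List.prod_cons, map_mul, h1, toCotwistHom_ι, cotwistι_mul_prod hF hL]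
    · rw [untwist, untwist_map hL (L_mem_permGroup x), h2]
      simp

omit [Finite X] in
theorem span_words (r : X × X → X × X) :
    Submodule.span ℂ (Set.range fun l : List X => (l.map (YangBaxterAlgebra.ι ℂ r)).prod) = ⊤ := by
  have h : Algebra.adjoin ℂ (Set.range (YangBaxterAlgebra.ι ℂ r)) = ⊤ := by
    have h1 := congrArg (Subalgebra.map (RingQuot.mkAlgHom ℂ (YangBaxterRel ℂ r)))
      (FreeAlgebra.adjoin_range_ι ℂ X)
    rwa [AlgHom.map_adjoin, ← Set.range_comp, Algebra.map_top, (AlgHom.range_eq_top _).2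
      (RingQuot.mkAlgHom_surjective ℂ (YangBaxterRel ℂ r))] at h1
  rw [eq_top_iff, ← Algebra.top_toSubmodule, ← h, Algebra.adjoin_eq_span]
  refine Submodule.span_mono fun a ha => ?_
  obtain ⟨l, hl, rfl⟩ := Submonoid.exists_list_of_mem_closure ha
  obtain ⟨l, rfl⟩ : l ∈ Set.range (List.map (YangBaxterAlgebra.ι ℂ r)) := by
    rw [Set.range_list_map]
    exact hl
  exact ⟨l, rfl⟩

theorem bijective_toCotwistHom (hL : ∀ x y, S.L (S.L x y) = S.L y) :
    Function.Bijective (toCotwistHom hF hL) := by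
  -- `untwistLinear` is only linear, so the two composites are checked on spanning words and on the
  -- monomial basis.
  have hleft : untwistLinear hL ∘ₗ (toCotwist S.polynomialGrading hF).symm.toLinearMap ∘ₗ
      (toCotwistHom hF hL).toLinearMap = LinearMap.id := by
    refine LinearMap.ext_on (span_words S.r) ?_
    rintro _ ⟨l, rfl⟩
    obtain ⟨l', h1, h2⟩ := exists_toCotwistHom_word hF hL l
    change untwistLinear hL ((toCotwist S.polynomialGrading hF).symm (toCotwistHom hF hL
      (l.map (YangBaxterAlgebra.ι ℂ S.r)).prod)) = (l.map (YangBaxterAlgebra.ι ℂ S.r)).prod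
    rw [h1, LinearEquiv.symm_apply_apply, untwistLinear_prod, h2]
  have hright : (toCotwistHom hF hL).toLinearMap ∘ₗ untwistLinear hL =
      (toCotwist S.polynomialGrading hF).toLinearMap := by
    classical
    refine (Finsupp.basisSingleOne (R := ℂ) (ι := X)).symmetricAlgebra.ext fun s => ?_
    obtain ⟨l, rfl⟩ : ∃ l : List X, s = Multiset.toFinsupp (l : Multiset X) :=
      ⟨(Finsupp.toMultiset s).toList, by simp⟩
    rw [basis_symmetricAlgebra_toFinsupp, LinearMap.comp_apply, untwistLinear_prod]
    exact (toCotwistHom_untwist hF hL (one_mem _) l).trans (by simp)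
  refine ⟨Function.LeftInverse.injective (g := fun p => untwistLinear hL
    ((toCotwist S.polynomialGrading hF).symm p)) (LinearMap.congr_fun hleft), fun p => ?_⟩
  exact ⟨_, LinearMap.congr_fun hright ((toCotwist S.polynomialGrading hF).symm p)⟩

end SymmetricSet

open SymmetricSet in
theorem proposition6p4 {X : Type u} [Finite X] (S : SymmetricSet X) (hsf : S.IsSquareFree)
    (hlevel : S.IsMultipermutationOfLevel 2) :
    -- the elements of one orbit act in the same way, and `H` is commutative
    (∀ x y : X, S.orbitOf x = S.orbitOf y → S.gamma x = S.gamma y) ∧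
    (∀ a b : S.GradingGroup, a * b = b * a) ∧
    -- `V` is `H`-graded
    DirectSum.IsInternal S.grading ∧
    -- `F` is a 2-cocycle on `H`, and `ℂ[V]` is an `H`-graded algebra
    ∃ (hF : IsTwoCocycle S.canonicalCocycle) (_ : GradedAlgebra S.polynomialGrading),
      -- `ℂ[V]^F ≅ ℂ_R[V]`
      (∃ e : Cotwist S.polynomialGrading hF ≃ₐ[ℂ] QuantumSpace (linearExtension ℂ S.r),
        ∀ v : X →₀ ℂ, e (toCotwist S.polynomialGrading hF (SymmetricAlgebra.ι ℂ (X →₀ ℂ) v)) =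
          QuantumSpace.ι (linearExtension ℂ S.r) v) ∧
      -- `ℂ[V]^F ≅ 𝒜(ℂ, X, r)`
      (∃ e : Cotwist S.polynomialGrading hF ≃ₐ[ℂ] YangBaxterAlgebra ℂ S.r,
        ∀ x : X, e (toCotwist S.polynomialGrading hF
            (SymmetricAlgebra.ι ℂ (X →₀ ℂ) (Finsupp.single x 1))) =
          YangBaxterAlgebra.ι ℂ S.r x) := by
  have hL := S.L_L_of_level_two hsf hlevel
  obtain ⟨hgr⟩ := nonempty_gradedAlgebra hL
  have hF : IsTwoCocycle S.canonicalCocycle := isTwoCocycle_canonicalCocycle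
  let e := (AlgEquiv.ofBijective _ (bijective_toCotwistHom hF hL)).symm
  have he : ∀ x : X, e (toCotwist S.polynomialGrading hF
      (SymmetricAlgebra.ι ℂ (X →₀ ℂ) (Finsupp.single x 1))) = YangBaxterAlgebra.ι ℂ S.r x :=
    fun x => (AlgEquiv.symm_apply_eq _).2 (toCotwistHom_ι hF hL x).symm
  refine ⟨fun x y => gamma_eq_of_orbitOf_eq hL, gradingGroup_mul_comm hL, isInternal_grading hL,
    hF, hgr, ⟨e.trans (YangBaxterAlgebra.equivQuantumSpace ℂ S.r), fun v => ?_⟩, e, he⟩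
  let f : (X →₀ ℂ) →ₗ[ℂ] QuantumSpace (linearExtension ℂ S.r) :=
    (e.trans (YangBaxterAlgebra.equivQuantumSpace ℂ S.r)).toLinearMap ∘ₗ
      (toCotwist S.polynomialGrading hF).toLinearMap ∘ₗ SymmetricAlgebra.ι ℂ (X →₀ ℂ)
  have hf : f = QuantumSpace.ι (linearExtension ℂ S.r) := by
    refine Finsupp.basisSingleOne.ext fun x => ?_
    rw [Finsupp.coe_basisSingleOne]
    exact (congrArg (YangBaxterAlgebra.equivQuantumSpace ℂ S.r) (he x)).trans
      (YangBaxterAlgebra.toQuantumSpace_ι ℂ S.r x)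
  exact LinearMap.congr_fun hf v
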